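/- Let $d\ge 2$. Let $\mathcal V$ be the real vector space of Hermitian matrices on $\mathbb C^d\otimes\mathbb C^d$ with inner product $\langle X,Y\rangle=\operatorname{Tr}XY$. A positive cone is a closed convex cone $\mathcal K\subset\mathcal V$ with non-empty interior and $\mathcal K\cap(-\mathcal K)=\{0\}$; its dual is $\mathcal K^*=\{x\in\mathcal V: \langle x,y\rangle\ge 0\ \forall y\in\mathcal K\}$. Let $\mathrm{SEP}$ be the cone of all finite sums $\sum_k a_k\otimes b_k$ with $a_k,b_k$ positive semidefinite matrices on $\mathbb C^d$, and let $\mathrm{SES}$ (the standard entanglement structure) be the cone of all positive semidefinite matrices on $\mathbb C^d\otimes\mathbb C^d$. An entanglement structure is a positive cone $\mathcal K\subset\mathcal V$ with $\mathrm{SEP}\subset\mathcal K\subset\mathrm{SEP}^*$ such that the identity matrix $I$ is an inner point of $\mathcal K^*$; its state space is $\mathcal S(\mathcal K)=\{\rho\in\mathcal K:\operatorname{Tr}\rho=1\}$. Let $\mathrm{ME}$ be the set of maximally entangled states $|\psi\rangle\langle\psi|$, $|\psi\rangle=\frac1{\sqrt d}\sum_{k=1}^d|a_k\rangle\otimes|b_k\rangle$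 with orthonormal bases $(a_k)$, $(b_k)$ of $\mathbb C^d$. For $\varepsilon>0$, an $\varepsilon$-pseudo standard entanglement structure ($\varepsilon$-PSES) is an entanglement structure $\mathcal K$ that is self-dual, $\mathcal K^*=\mathcal K$, and satisfies $$D(\mathcal K):=\max_{\sigma\in\mathrm{ME}}\ \min_{\rho\in\mathcal S(\mathcal K)}\|\rho-\sigma\|_1\le\varepsilon ,$$ where $\|\cdot\|_1$ is the trace norm. A family $\mathcal K_1,\dots,\mathcal K_n$ is $n$-independent if for no $i$ does $\mathcal K_i\subset\sum_{j\ne i}\mathcal K_j$ hold. Theorem. For every $\varepsilon>0$ there are infinitely many $\varepsilon$-PSESs different from $\mathrm{SES}$. Moreover, for every natural number $n$ there is an $n$-independent family $\mathcal K_1,\dots,\mathcal K_n$ of $\varepsilon$-PSESs, all of them different from $\mathrm{SES}$. -/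

import Mathlib

open scoped Pointwise Kronecker ENNReal ComplexOrder

noncomputable section

namespace EntanglementStructure

/-- `𝒯(ℂ^ι)`: the real vector space of Hermitian matrices on the Hilbert space `ℂ^ι`. -/
abbrev Herm (ι : Type) [Fintype ι] [DecidableEq ι] : Type :=
  selfAdjoint (Matrix ι ι ℂ)

section General

variable {ι : Type} [Fintype ι] [DecidableEq ι]

/-- The inner product `⟨X, Y⟩ = Tr (X Y)`, a real number for Hermitian `X`, `Y`. -/
def hsInner (X Y : Herm ι) : ℝ :=
  ((X : Matrix ι ι ℂ) * (Y : Matrix ι ι ℂ)).trace.re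

/-- The trace norm of a Hermitian matrix: the sum of the absolute values of its eigenvalues,
counted with multiplicity. -/
def traceNorm (X : Herm ι) : ℝ :=
  ∑ i, |Matrix.IsHermitian.eigenvalues (A := (X : Matrix ι ι ℂ)) X.2 i|

/-- A positive cone: a closed convex cone with an inner point and with `K ∩ (-K) = {0}`. -/
structure IsPositiveCone (K : Set (Herm ι)) : Prop where
  isClosed : IsClosed K
  convex : Convex ℝ K
  smul_mem : ∀ c : ℝ, 0 ≤ c → ∀ x ∈ K, c • x ∈ K
  interior_nonempty : (interior K).Nonempty
  inter_neg : K ∩ -K = {0}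

/-- The dual cone `K* = {x | ⟨x, y⟩ ≥ 0 for all y ∈ K}`. -/
def dual (K : Set (Herm ι)) : Set (Herm ι) :=
  {x | ∀ y ∈ K, 0 ≤ hsInner x y}

/-- The cone `𝒯₊(ℂ^ι)` of positive semidefinite matrices. -/
def psd (ι : Type) [Fintype ι] [DecidableEq ι] : Set (Herm ι) :=
  {X | (X : Matrix ι ι ℂ).PosSemidef}

/-- The state space of the model with cone `K` and unit `u`. -/
def stateSpace (K : Set (Herm ι)) (u : Herm ι) : Set (Herm ι) :=
  {ρ | ρ ∈ K ∧ hsInner ρ u = 1}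

/-- The tensor product of two cones: all finite sums `∑ₖ aₖ ⊗ bₖ` with `aₖ ∈ K`, `bₖ ∈ L`. -/
def tensorCone {κ : Type} [Fintype κ] [DecidableEq κ] (K : Set (Herm ι)) (L : Set (Herm κ)) :
    Set (Herm (ι × κ)) :=
  {X | ∃ (N : ℕ) (a : Fin N → Herm ι) (b : Fin N → Herm κ),
    (∀ k, a k ∈ K) ∧ (∀ k, b k ∈ L) ∧
    (X : Matrix (ι × κ) (ι × κ) ℂ) =
      ∑ k, (a k : Matrix ι ι ℂ) ⊗ₖ (b k : Matrix κ κ ℂ)}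

/-- `D(K‖σ)`: the distance in trace norm from `σ` to the state space of `K` (with unit `I`). -/
def distToState (K : Set (Herm ι)) (σ : Herm ι) : ℝ≥0∞ :=
  ⨅ ρ ∈ stateSpace K 1, ENNReal.ofReal (traceNorm (ρ - σ))

/-- Independence of a finite family of sets: no `K i` lies in the sum of the others. -/
def IsIndependentFamily {n : ℕ} (K : Fin n → Set (Herm ι)) : Prop :=
  ∀ i, ¬ K i ⊆ ∑ j ∈ Finset.univ.erase i, K j

end General

/-- `SEP`: the separable cone on `ℂ^d ⊗ ℂ^d`. -/
def SEP (d : ℕ) : Set (Herm (Fin d × Fin d)) :=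
  tensorCone (psd (Fin d)) (psd (Fin d))

/-- `SES`: the standard entanglement structure on `ℂ^d ⊗ ℂ^d`. -/
def SES (d : ℕ) : Set (Herm (Fin d × Fin d)) :=
  psd (Fin d × Fin d)

/-- The vector `d^(-1/2) ∑ₖ aₖ ⊗ bₖ` built from orthonormal bases `a`, `b` of `ℂ^d`. -/
def maxEntVec {d : ℕ} (a b : OrthonormalBasis (Fin d) ℂ (EuclideanSpace ℂ (Fin d))) :
    Fin d × Fin d → ℂ :=
  fun p => ((Real.sqrt d : ℝ) : ℂ)⁻¹ * ∑ k, a k p.1 * b k p.2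

/-- `ME`: the maximally entangled states `|ψ⟩⟨ψ|` on `ℂ^d ⊗ ℂ^d`. -/
def ME (d : ℕ) : Set (Herm (Fin d × Fin d)) :=
  {σ | ∃ a b : OrthonormalBasis (Fin d) ℂ (EuclideanSpace ℂ (Fin d)),
    (σ : Matrix (Fin d × Fin d) (Fin d × Fin d) ℂ) =
      Matrix.vecMulVec (maxEntVec a b) (star (maxEntVec a b))}

/-- `D(K)`: the largest distance of a maximally entangled state from the state space of `K`. -/
def maxEntDist {d : ℕ} (K : Set (Herm (Fin d × Fin d))) : ℝ≥0∞ :=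
  ⨆ σ ∈ ME d, distToState K σ

/-- An entanglement structure on `ℂ^d ⊗ ℂ^d`: a positive cone `K` whose dual has the unit `I` as an
inner point, with `SEP ⊆ K ⊆ SEP*`. -/
structure IsEntanglementStructure {d : ℕ} (K : Set (Herm (Fin d × Fin d))) : Prop where
  isPositiveCone : IsPositiveCone K
  unit_mem_interior_dual : (1 : Herm (Fin d × Fin d)) ∈ interior (dual K)
  sep_subset : SEP d ⊆ K
  subset_dual_sep : K ⊆ dual (SEP d)

/-- An `ε`-pseudo standard entanglement structure: a self-dual entanglement structure with
`D(K) ≤ ε`. -/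
structure IsPSES {d : ℕ} (ε : ℝ) (K : Set (Herm (Fin d × Fin d))) : Prop where
  isEntanglementStructure : IsEntanglementStructure K
  selfDual : dual K = K
  undistinguishable : maxEntDist K ≤ ENNReal.ofReal ε

end EntanglementStructure

end

/-! By Zorn's lemma, every set of Hermitian matrices with pairwise non-negative inner products lies
in a self-dual set (`exists_selfDual_superset`). A self-dual set containing `SEP` is automatically
an entanglement structure, so it suffices to choose a suitable generating set.

Take distinct maximally entangled states `φ i` and a number `t` slightly above 1. The operator `1 -
t • φ i` is negative on `φ i`, yet non-negative on product states, whose overlap with `φ i` is at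
most `1 / d` relative to their trace. It is also non-negative on every maximally entangled state
mixed with a little white noise, and on each `φ j` with `j ≠ i`, since these overlaps are strictly
below 1. All these matrices other than the witness are positive semidefinite, so together they
generate a self-dual `K i`.

The noisy states give `D(K i) ≤ ε`, and the witness keeps `K i` away from `SES`. For `j ≠ i`, `φ i`
lies in `K j = dual (K j)`, so it is non-negative on the sum of these cones but negative on the
witness in `K i`: the family is independent. Independent families are injective, and their unbounded
length gives infinitely many structures. -/

namespace EntanglementStructure

/-! ### Trace inner product and trace norm -/

section General

variable {ι : Type} [Fintype ι] [DecidableEq ι]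

open Matrix

theorem hsInner_comm (X Y : Herm ι) : hsInner X Y = hsInner Y X := by
  unfold hsInner; rw [Matrix.trace_mul_comm]

theorem hsInner_add_left (X Y Z : Herm ι) : hsInner (X + Y) Z = hsInner X Z + hsInner Y Z := by
  simp [hsInner, add_mul]

theorem hsInner_sub_left (X Y Z : Herm ι) : hsInner (X - Y) Z = hsInner X Z - hsInner Y Z := by
  simp [hsInner, sub_mul]

theorem hsInner_smul_left (c : ℝ) (X Z : Herm ι) : hsInner (c • X) Z = c * hsInner X Z := by
  simp [hsInner]

theorem hsInner_add_right (X Y Z : Herm ι) : hsInner X (Y + Z) = hsInner X Y + hsInner X Z := by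
  simp [hsInner, mul_add]

theorem hsInner_sub_right (X Y Z : Herm ι) : hsInner X (Y - Z) = hsInner X Y - hsInner X Z := by
  simp [hsInner, mul_sub]

theorem hsInner_smul_right (c : ℝ) (X Z : Herm ι) : hsInner X (c • Z) = c * hsInner X Z := by
  simp [hsInner]

theorem continuous_hsInner_left (Y : Herm ι) : Continuous fun X : Herm ι => hsInner X Y := by
  unfold hsInner; fun_prop

theorem hsInner_one_one : hsInner (1 : Herm ι) 1 = Fintype.card ι := by
  simp [hsInner]

theorem hsInner_self_nonneg (X : Herm ι) : 0 ≤ hsInner X X := by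
  have h := (posSemidef_conjTranspose_mul_self (X : Matrix ι ι ℂ)).trace_nonneg
  rw [show (X : Matrix ι ι ℂ)ᴴ = X from X.2] at h
  exact (Complex.le_def.1 h).1

theorem eq_zero_of_hsInner_self {X : Herm ι} (h : hsInner X X = 0) : X = 0 := by
  have h1 := (posSemidef_conjTranspose_mul_self (X : Matrix ι ι ℂ)).trace_nonneg
  have h2 : ((X : Matrix ι ι ℂ)ᴴ * (X : Matrix ι ι ℂ)).trace = 0 := by
    refine Complex.ext ?_ (Complex.le_def.1 h1).2.symm
    rw [show (X : Matrix ι ι ℂ)ᴴ = X from X.2]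
    exact h
  exact Subtype.ext (trace_conjTranspose_mul_self_eq_zero_iff.1 h2)

theorem hsInner_self_pos {X : Herm ι} (h : X ≠ 0) : 0 < hsInner X X :=
  (hsInner_self_nonneg X).lt_of_ne fun h' => h (eq_zero_of_hsInner_self h'.symm)

open scoped MatrixOrder Matrix.Norms.L2Operator in
theorem trace_mul_nonneg {A B : Matrix ι ι ℂ} (hA : A.PosSemidef) (hB : B.PosSemidef) :
    0 ≤ (A * B).trace := by
  obtain ⟨C, rfl⟩ := CStarAlgebra.nonneg_iff_eq_star_mul_self.mp hA.nonneg
  rw [star_eq_conjTranspose]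
  rw [Matrix.mul_assoc, Matrix.trace_mul_comm]
  exact (hB.mul_mul_conjTranspose_same C).trace_nonneg

theorem hsInner_nonneg_of_psd {X Y : Herm ι} (hX : X ∈ psd ι) (hY : Y ∈ psd ι) :
    0 ≤ hsInner X Y :=
  (Complex.le_def.1 (trace_mul_nonneg hX hY)).1

/-- Each eigenvalue of `A` is at most the sum of all of them; diagonalize. -/
theorem posSemidef_trace_smul_one_sub {A : Matrix ι ι ℂ} (hA : A.PosSemidef) :
    (A.trace • (1 : Matrix ι ι ℂ) - A).PosSemidef := by
  have hs := hA.1.spectral_theorem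
  set U := hA.1.eigenvectorUnitary
  rw [Unitary.conjStarAlgAut_apply] at hs
  have hU : (U : Matrix ι ι ℂ) * star (U : Matrix ι ι ℂ) = 1 := Unitary.coe_mul_star_self U
  have : A.trace • (1 : Matrix ι ι ℂ) - A =
      U * (Matrix.diagonal fun i => ((∑ j, hA.1.eigenvalues j - hA.1.eigenvalues i : ℝ) : ℂ)) *
        (U : Matrix ι ι ℂ)ᴴ := by
    have hd : (Matrix.diagonal fun i => ((∑ j, hA.1.eigenvalues j - hA.1.eigenvalues i : ℝ) : ℂ))
        = A.trace • (1 : Matrix ι ι ℂ) - Matrix.diagonal (RCLike.ofReal ∘ hA.1.eigenvalues) := by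
      rw [hA.1.trace_eq_sum_eigenvalues, Matrix.smul_one_eq_diagonal, Matrix.diagonal_sub]
      congr 1; funext i; simp
    rw [hd, Matrix.mul_sub, Matrix.sub_mul]
    rw [star_eq_conjTranspose] at hs hU
    rw [← hs, Matrix.mul_smul, Matrix.mul_one, Matrix.smul_mul, hU]
  rw [this]
  refine PosSemidef.mul_mul_conjTranspose_same (PosSemidef.diagonal fun i => ?_) _
  have h0 := Finset.single_le_sum (f := hA.1.eigenvalues)
    (fun j _ => hA.eigenvalues_nonneg j) (Finset.mem_univ i)
  have h1 : 0 ≤ ∑ j, hA.1.eigenvalues j - hA.1.eigenvalues i := sub_nonneg.2 h0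
  change (0 : ℂ) ≤ _
  exact_mod_cast h1

theorem trace_mul_le {A B : Matrix ι ι ℂ} (hA : A.PosSemidef) (hB : B.PosSemidef) :
    (A * B).trace ≤ A.trace * B.trace := by
  have := trace_mul_nonneg (posSemidef_trace_smul_one_sub hA) hB
  rw [Matrix.sub_mul, Matrix.trace_sub] at this
  simpa using sub_nonneg.1 this

theorem hsInner_self_eq_sum_sq (X : Herm ι) :
    hsInner X X = ∑ i, Matrix.IsHermitian.eigenvalues (A := (X : Matrix ι ι ℂ)) X.2 i ^ 2 := by
  have hX : (X : Matrix ι ι ℂ).IsHermitian := X.2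
  have hs := hX.spectral_theorem
  set U := hX.eigenvectorUnitary
  have h2 : (X : Matrix ι ι ℂ) * X = Unitary.conjStarAlgAut ℂ _ U
      (Matrix.diagonal (RCLike.ofReal ∘ hX.eigenvalues) *
        Matrix.diagonal (RCLike.ofReal ∘ hX.eigenvalues)) := by
    rw [map_mul, ← hs]
  unfold hsInner
  rw [h2, Unitary.conjStarAlgAut_apply, Matrix.trace_mul_cycle, Unitary.coe_star_mul_self,
    Matrix.one_mul, Matrix.diagonal_mul_diagonal, Matrix.trace_diagonal]
  simp [pow_two]

/-- Cauchy–Schwarz on the eigenvalues; it reduces trace-norm estimates to inner products. -/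
theorem traceNorm_sq_le (X : Herm ι) : traceNorm X ^ 2 ≤ Fintype.card ι * hsInner X X := by
  rw [hsInner_self_eq_sum_sq, traceNorm]
  simpa using sq_sum_le_card_mul_sum_sq (s := Finset.univ)
    (f := fun i => |Matrix.IsHermitian.eigenvalues (A := (X : Matrix ι ι ℂ)) X.2 i|)

/-! ### Self-dual extensions and independence -/

/-- A set is self-dual as soon as it is maximal among the sets with non-negative inner products. -/
theorem exists_selfDual_superset {L : Set (Herm ι)} (hL : ∀ x ∈ L, ∀ y ∈ L, 0 ≤ hsInner x y) :
    ∃ K, L ⊆ K ∧ dual K = K := by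
  obtain ⟨K, hLK, hK⟩ := zorn_subset_nonempty
    {K : Set (Herm ι) | ∀ x ∈ K, ∀ y ∈ K, 0 ≤ hsInner x y}
    (fun c hc hchain _ => ⟨⋃₀ c, fun x ⟨s, hs, hx⟩ y ⟨t, ht, hy⟩ => by
      rcases hchain.total hs ht with h | h
      · exact hc ht x (h hx) y hy
      · exact hc hs x hx y (h hy), fun s hs => Set.subset_sUnion_of_mem hs⟩) L hL
  refine ⟨K, hLK, Set.Subset.antisymm (fun x hx => ?_) fun x hx y hy => hK.prop x hx y hy⟩
  -- Adjoining a dual element `x` keeps all products non-negative, because `⟨x, x⟩ ≥ 0`; maximality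
  -- then puts `x` in `K`.
  refine hK.le_of_ge (y := insert x K) ?_ (Set.subset_insert _ _) (Set.mem_insert _ _)
  rintro a (rfl | ha) b (rfl | hb)
  · exact hsInner_self_nonneg _
  · exact hx b hb
  · exact hsInner_comm a _ ▸ hx a ha
  · exact hK.prop a ha b hb

theorem exists_selfDual_insert {P : Set (Herm ι)} {w : Herm ι}
    (hP : ∀ x ∈ P, ∀ y ∈ P, 0 ≤ hsInner x y) (hw : ∀ x ∈ P, 0 ≤ hsInner w x) :
    ∃ K, w ∈ K ∧ P ⊆ K ∧ dual K = K := by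
  obtain ⟨K, hPK, hK⟩ := exists_selfDual_superset (L := insert w P) (by
    rintro x (rfl | hx) y (rfl | hy)
    · exact hsInner_self_nonneg _
    · exact hw y hy
    · exact hsInner_comm x _ ▸ hw x hx
    · exact hP x hx y hy)
  exact ⟨K, hPK (Set.mem_insert _ _), (Set.subset_insert _ _).trans hPK, hK⟩

theorem isClosed_dual (K : Set (Herm ι)) : IsClosed (dual K) := by
  have : dual K = ⋂ y ∈ K, {x | 0 ≤ hsInner x y} := by ext; simp [dual]
  rw [this]
  exact isClosed_biInter fun y _ => isClosed_le continuous_const (continuous_hsInner_left y)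

theorem add_mem_dual {K : Set (Herm ι)} {x y : Herm ι} (hx : x ∈ dual K) (hy : y ∈ dual K) :
    x + y ∈ dual K := fun z hz => by
  rw [hsInner_add_left]; exact add_nonneg (hx z hz) (hy z hz)

theorem smul_mem_dual {K : Set (Herm ι)} {c : ℝ} (hc : 0 ≤ c) {x : Herm ι} (hx : x ∈ dual K) :
    c • x ∈ dual K := fun z hz => by
  rw [hsInner_smul_left]; exact mul_nonneg hc (hx z hz)

theorem dual_anti {K L : Set (Herm ι)} (h : K ⊆ L) : dual L ⊆ dual K :=
  fun _ hx y hy => hx y (h hy)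

theorem zero_mem_dual (K : Set (Herm ι)) : (0 : Herm ι) ∈ dual K := fun y _ => by simp [hsInner]

/-- A dual is always a closed convex cone. Pointedness comes from self-duality: `x` and `-x` in `K`
force `-⟨x, x⟩ ≥ 0`. -/
theorem isPositiveCone_of_dual_eq {K : Set (Herm ι)} (hK : dual K = K)
    (hint : (interior K).Nonempty) : IsPositiveCone K where
  isClosed := hK ▸ isClosed_dual K
  convex := by
    rw [← hK]
    exact fun x hx y hy a b ha hb _ => add_mem_dual (smul_mem_dual ha hx) (smul_mem_dual hb hy)
  smul_mem := by
    intro c hc x hx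
    rw [← hK] at hx ⊢
    exact smul_mem_dual hc hx
  interior_nonempty := hint
  inter_neg := by
    refine Set.Subset.antisymm (fun x hx => ?_) ?_
    · have h1 : x ∈ dual K := hK.symm ▸ hx.1
      have h2 := h1 _ hx.2
      rw [← neg_one_smul ℝ, hsInner_smul_right] at h2
      exact eq_zero_of_hsInner_self (le_antisymm (by linarith) (hsInner_self_nonneg x))
    · rintro _ rfl
      have : (0 : Herm ι) ∈ K := hK ▸ zero_mem_dual K
      exact ⟨this, by simpa using this⟩

theorem nonneg_of_mem_sum {n : ℕ} {K : Fin n → Set (Herm ι)} (s : Finset (Fin n)) {w x : Herm ι}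
    (hw : ∀ j ∈ s, w ∈ dual (K j)) (hx : x ∈ ∑ j ∈ s, K j) : 0 ≤ hsInner w x := by
  rw [Set.mem_finsetSum] at hx
  obtain ⟨g, hg, rfl⟩ := hx
  have : hsInner w (∑ j ∈ s, g j) = ∑ j ∈ s, hsInner w (g j) := by
    simp [hsInner, Finset.mul_sum, Matrix.trace_sum]
  rw [this]
  exact Finset.sum_nonneg fun j hj => hw j hj _ (hg hj)

/-- Separating elements `w i` prove a family of self-dual cones independent. -/
theorem isIndependentFamily_of_witness {n : ℕ} {K : Fin n → Set (Herm ι)} (w m : Fin n → Herm ι)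
    (hm : ∀ i, m i ∈ K i) (hw : ∀ i j, i ≠ j → w i ∈ dual (K j))
    (hneg : ∀ i, hsInner (w i) (m i) < 0) : IsIndependentFamily K := fun i h =>
  (hneg i).not_ge (nonneg_of_mem_sum _ (fun j hj => hw i j (Finset.ne_of_mem_erase hj).symm)
    (h (hm i)))

/-- If `K i = K j` with `i ≠ j`, then `K i` is contained in the sum of the others, by taking 0 in
every summand except `K j`. -/
theorem IsIndependentFamily.injective {n : ℕ} {K : Fin n → Set (Herm ι)}
    (h : IsIndependentFamily K) (h0 : ∀ i, (0 : Herm ι) ∈ K i) : Function.Injective K := by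
  intro i j hij
  by_contra hne
  refine h i fun x hx => ?_
  rw [Set.mem_finsetSum]
  refine ⟨fun k => if k = j then x else 0, fun {k} _ => ?_, ?_⟩
  · dsimp only
    split_ifs with hk
    · subst hk; exact hij ▸ hx
    · exact h0 k
  · rw [Finset.sum_ite_eq', if_pos (Finset.mem_erase.2 ⟨Ne.symm hne, Finset.mem_univ _⟩)]

end General
end EntanglementStructure
namespace EntanglementStructure

/-! ### The separable cone, and the unit as an inner point -/

section Tensor

open Matrix

variable {d : ℕ}

/-- The Kronecker product of two Hermitian matrices, as a Hermitian matrix. -/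
def hermKron (a b : Herm (Fin d)) : Herm (Fin d × Fin d) :=
  ⟨(a : Matrix (Fin d) (Fin d) ℂ) ⊗ₖ (b : Matrix (Fin d) (Fin d) ℂ), by
    rw [selfAdjoint.mem_iff, star_eq_conjTranspose, conjTranspose_kronecker]
    exact congrArg₂ _ a.2 b.2⟩

theorem hermKron_mem_SEP {a b : Herm (Fin d)} (ha : a ∈ psd (Fin d)) (hb : b ∈ psd (Fin d)) :
    hermKron a b ∈ SEP d :=
  ⟨1, fun _ => a, fun _ => b, fun _ => ha, fun _ => hb, by simp [hermKron]⟩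

theorem exists_sum_hermKron {X : Herm (Fin d × Fin d)} (hX : X ∈ SEP d) :
    ∃ (N : ℕ) (a b : Fin N → Herm (Fin d)), (∀ k, a k ∈ psd (Fin d)) ∧ (∀ k, b k ∈ psd (Fin d)) ∧
      X = ∑ k, hermKron (a k) (b k) := by
  obtain ⟨N, a, b, ha, hb, h⟩ := hX
  refine ⟨N, a, b, ha, hb, Subtype.ext ?_⟩
  rw [h]
  simp [hermKron]

theorem hsInner_nonneg_of_mem_SEP {X Y : Herm (Fin d × Fin d)} (hX : X ∈ SEP d)
    (hY : ∀ a ∈ psd (Fin d), ∀ b ∈ psd (Fin d), 0 ≤ hsInner Y (hermKron a b)) :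
    0 ≤ hsInner Y X := by
  obtain ⟨N, a, b, ha, hb, rfl⟩ := exists_sum_hermKron hX
  have : hsInner Y (∑ k, hermKron (a k) (b k)) = ∑ k, hsInner Y (hermKron (a k) (b k)) := by
    simp [hsInner, Finset.mul_sum, Matrix.trace_sum]
  rw [this]
  exact Finset.sum_nonneg fun k _ => hY _ (ha k) _ (hb k)

theorem SEP_subset_SES : SEP d ⊆ SES d := by
  rintro X ⟨N, a, b, ha, hb, h⟩
  change (X : Matrix (Fin d × Fin d) (Fin d × Fin d) ℂ).PosSemidef
  rw [h]
  exact posSemidef_sum _ fun k _ => (ha k).kronecker (hb k)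

/-- Polarization of the sesquilinear expression `1ᴴ * X`. -/
theorem mem_span_posSemidef {ι : Type} [Fintype ι] [DecidableEq ι] (X : Matrix ι ι ℂ) :
    X ∈ Submodule.span ℂ {P : Matrix ι ι ℂ | P.PosSemidef} := by
  have h : X = (1 / 4 : ℂ) • ((1 + X)ᴴ * (1 + X)) - (1 / 4 : ℂ) • ((1 - X)ᴴ * (1 - X)) -
      (Complex.I / 4) • ((1 + Complex.I • X)ᴴ * (1 + Complex.I • X)) +
      (Complex.I / 4) • ((1 - Complex.I • X)ᴴ * (1 - Complex.I • X)) := by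
    simp only [conjTranspose_add, conjTranspose_sub, conjTranspose_one, conjTranspose_smul,
      Matrix.add_mul, Matrix.sub_mul, Matrix.mul_add, Matrix.mul_sub, Matrix.one_mul,
      Matrix.mul_one, Matrix.smul_mul, Matrix.mul_smul, smul_add, smul_sub, smul_smul]
    ext i j
    simp only [Matrix.add_apply, Matrix.sub_apply, Matrix.smul_apply, smul_eq_mul,
      Complex.star_def, Complex.conj_I]
    ring_nf
    simp only [Complex.I_sq]
    ring
  rw [h]
  have hs : ∀ Y : Matrix ι ι ℂ, Yᴴ * Y ∈ Submodule.span ℂ {P : Matrix ι ι ℂ | P.PosSemidef} :=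
    fun Y => Submodule.subset_span (posSemidef_conjTranspose_mul_self Y)
  exact add_mem (sub_mem (sub_mem (Submodule.smul_mem _ _ (hs _)) (Submodule.smul_mem _ _ (hs _)))
    (Submodule.smul_mem _ _ (hs _))) (Submodule.smul_mem _ _ (hs _))

/-- The matrices that the trace bounds uniformly on the dual of the separable cone. -/
def traceBounded (d : ℕ) : Submodule ℂ (Matrix (Fin d × Fin d) (Fin d × Fin d) ℂ) where
  carrier := {X | ∃ c : ℝ, ∀ y ∈ dual (SEP d),
    ‖((y : Matrix (Fin d × Fin d) (Fin d × Fin d) ℂ) * X).trace‖ ≤ c * hsInner y 1}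
  zero_mem' := ⟨0, fun y _ => by simp⟩
  add_mem' := by
    rintro X Y ⟨c, hc⟩ ⟨c', hc'⟩
    refine ⟨c + c', fun y hy => ?_⟩
    rw [Matrix.mul_add, Matrix.trace_add, add_mul]
    exact (norm_add_le _ _).trans (add_le_add (hc y hy) (hc' y hy))
  smul_mem' := by
    rintro z X ⟨c, hc⟩
    refine ⟨‖z‖ * c, fun y hy => ?_⟩
    rw [Matrix.mul_smul, Matrix.trace_smul, norm_smul, mul_assoc]
    exact mul_le_mul_of_nonneg_left (hc y hy) (norm_nonneg z)

theorem norm_trace_mul_eq {ι : Type} [Fintype ι] [DecidableEq ι] (X Y : Herm ι) :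
    ‖((X : Matrix ι ι ℂ) * (Y : Matrix ι ι ℂ)).trace‖ = |hsInner X Y| := by
  have h : star ((X : Matrix ι ι ℂ) * (Y : Matrix ι ι ℂ)).trace =
      ((X : Matrix ι ι ℂ) * (Y : Matrix ι ι ℂ)).trace := by
    rw [← Matrix.trace_conjTranspose, conjTranspose_mul,
      show (X : Matrix ι ι ℂ)ᴴ = X from X.2, show (Y : Matrix ι ι ℂ)ᴴ = Y from Y.2,
      Matrix.trace_mul_comm]
  obtain ⟨r, hr⟩ := Complex.conj_eq_iff_real.1 h
  rw [hsInner, hr]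
  simp

/-- In the order defined by `SEP`, `a ⊗ b ≤ (Tr b) a ⊗ 1 ≤ (Tr a)(Tr b) 1 ⊗ 1`, as both differences
are product elements. -/
theorem hsInner_hermKron_le {y : Herm (Fin d × Fin d)} (hy : y ∈ dual (SEP d)) {a b : Herm (Fin d)}
    (ha : a ∈ psd (Fin d)) (hb : b ∈ psd (Fin d)) :
    hsInner y (hermKron a b) ≤ hsInner a 1 * hsInner b 1 * hsInner y 1 := by
  have key : ∀ {c : Herm (Fin d)}, c ∈ psd (Fin d) →
      hsInner c 1 • (1 : Herm (Fin d)) - c ∈ psd (Fin d) := by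
    intro c hc
    have h := posSemidef_trace_smul_one_sub hc
    have hr : (c : Matrix (Fin d) (Fin d) ℂ).trace = (hsInner c 1 : ℂ) := by
      refine Complex.ext (by simp [hsInner]) ?_
      simpa using (Complex.le_def.1 (PosSemidef.trace_nonneg hc)).2.symm
    rw [hr] at h
    exact h
  have h1 := hy _ (hermKron_mem_SEP (key ha) (a := _) (b := 1) PosSemidef.one)
  have h2 := hy _ (hermKron_mem_SEP ha (key hb))
  have e1 : hermKron (hsInner a 1 • (1 : Herm (Fin d)) - a) 1 =
      hsInner a 1 • (1 : Herm (Fin d × Fin d)) - hermKron a 1 := by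
    apply Subtype.ext
    ext p q
    simp [hermKron, Matrix.one_apply, Prod.ext_iff]
    split_ifs <;> simp_all
  have e2 : hermKron a (hsInner b 1 • (1 : Herm (Fin d)) - b) =
      hsInner b 1 • hermKron a 1 - hermKron a b := by
    apply Subtype.ext
    ext p q
    simp [hermKron, mul_sub, Matrix.one_apply, mul_comm]
  rw [e1, hsInner_sub_right, hsInner_smul_right] at h1
  rw [e2, hsInner_sub_right, hsInner_smul_right] at h2
  have hb0 : 0 ≤ hsInner b 1 := hsInner_nonneg_of_psd hb PosSemidef.one
  nlinarith [mul_nonneg hb0 h1]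

/-- The bound holds on products of positive semidefinite matrices, extends linearly in each factor,
and reaches everything because matrix units are Kronecker products. -/
theorem mem_traceBounded (X : Matrix (Fin d × Fin d) (Fin d × Fin d) ℂ) : X ∈ traceBounded d := by
  have hpp : ∀ a b : Matrix (Fin d) (Fin d) ℂ, a.PosSemidef → b.PosSemidef →
      a ⊗ₖ b ∈ traceBounded d := by
    intro a b ha hb
    let a' : Herm (Fin d) := ⟨a, ha.1⟩
    let b' : Herm (Fin d) := ⟨b, hb.1⟩
    refine ⟨hsInner a' 1 * hsInner b' 1, fun y hy => ?_⟩
    have hk := norm_trace_mul_eq y (hermKron a' b')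
    rw [abs_of_nonneg (hy _ (hermKron_mem_SEP (a := a') (b := b') ha hb))] at hk
    exact hk.le.trans (hsInner_hermKron_le hy (a := a') (b := b') ha hb)
  have hp : ∀ a b : Matrix (Fin d) (Fin d) ℂ, b.PosSemidef → a ⊗ₖ b ∈ traceBounded d := by
    intro a b hb
    refine Submodule.span_induction (p := fun a _ => a ⊗ₖ b ∈ traceBounded d)
      (fun a ha => hpp a b ha hb) ?_ ?_ ?_ (mem_span_posSemidef a)
    · simp
    · intro x y _ _ hx hy; rw [add_kronecker]; exact add_mem hx hy
    · intro z x _ hx; rw [smul_kronecker]; exact Submodule.smul_mem _ _ hx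
  have hab : ∀ a b : Matrix (Fin d) (Fin d) ℂ, a ⊗ₖ b ∈ traceBounded d := by
    intro a b
    refine Submodule.span_induction (p := fun b _ => a ⊗ₖ b ∈ traceBounded d)
      (fun b hb => hp a b hb) ?_ ?_ ?_ (mem_span_posSemidef b)
    · simp
    · intro x y _ _ hx hy; rw [kronecker_add]; exact add_mem hx hy
    · intro z x _ hx; rw [kronecker_smul]; exact Submodule.smul_mem _ _ hx
  rw [Matrix.matrix_eq_sum_single X]
  refine sum_mem fun p _ => sum_mem fun q _ => ?_
  have : Matrix.single p q (X p q) =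
      Matrix.single p.1 q.1 (X p q) ⊗ₖ Matrix.single p.2 q.2 (1 : ℂ) := by
    rw [single_kronecker_single]; simp
  rw [this]
  exact hab _ _

/-- The unit is an inner point of every self-dual cone that contains the separable one. -/
theorem one_mem_interior {K : Set (Herm (Fin d × Fin d))} (hK : dual K = K) (hS : SEP d ⊆ K) :
    1 ∈ interior K := by
  choose c hc using fun p q : Fin d × Fin d => mem_traceBounded (Matrix.single p q (1 : ℂ))
  -- With `c p q` the bounds for the matrix units, `|⟨y, X - 1⟩| ≤ f X * Tr y` for `y ∈ K`. Hence `f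
  -- X < 1` gives `⟨X, y⟩ ≥ 0`, and `X ∈ dual K = K`.
  let f : Herm (Fin d × Fin d) → ℝ := fun X => ∑ p, ∑ q,
    ‖(X : Matrix (Fin d × Fin d) (Fin d × Fin d) ℂ) p q - (1 : Matrix _ _ ℂ) p q‖ * c p q
  have hf : Continuous f := by
    have : ∀ p q, Continuous fun X : Herm (Fin d × Fin d) =>
        (X : Matrix (Fin d × Fin d) (Fin d × Fin d) ℂ) p q :=
      fun p q => (continuous_apply_apply p q).comp continuous_subtype_val
    exact continuous_finsetSum _ fun p _ => continuous_finsetSum _ fun q _ =>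
      ((this p q).sub continuous_const).norm.mul continuous_const
  refine mem_interior.2 ⟨{X | f X < 1}, fun X hX => ?_, isOpen_lt hf continuous_const, ?_⟩
  · rw [← hK]
    intro y hy
    have hyS : y ∈ dual (SEP d) := dual_anti hS (hK.symm ▸ hy)
    have hX1 : hsInner X y = hsInner y 1 + hsInner y (X - 1) := by
      rw [hsInner_sub_right, hsInner_comm X y]; ring
    have htr : 0 ≤ hsInner y 1 := by
      have h1 : hermKron (1 : Herm (Fin d)) 1 = 1 := by
        apply Subtype.ext; simp [hermKron]
      exact h1 ▸ hyS _ (hermKron_mem_SEP (d := d) PosSemidef.one PosSemidef.one)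
    have hbound : |hsInner y (X - 1)| ≤ f X * hsInner y 1 := by
      rw [← norm_trace_mul_eq]
      have hexp := Matrix.matrix_eq_sum_single
        ((X - 1 : Herm (Fin d × Fin d)) : Matrix (Fin d × Fin d) (Fin d × Fin d) ℂ)
      rw [hexp]
      simp only [Finset.mul_sum, Matrix.trace_sum, f, Finset.sum_mul]
      refine (norm_sum_le _ _).trans (Finset.sum_le_sum fun p _ => ?_)
      refine (norm_sum_le _ _).trans (Finset.sum_le_sum fun q _ => ?_)
      have hs : ∀ z : ℂ, Matrix.single p q z = z • Matrix.single p q (1 : ℂ) := by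
        intro z; simp
      rw [hs, Matrix.mul_smul, Matrix.trace_smul, norm_smul, mul_assoc]
      exact mul_le_mul_of_nonneg_left (hc p q y hyS) (norm_nonneg _)
    have h3 := neg_abs_le (hsInner y (X - 1))
    have hX' : f X < 1 := hX
    rw [hX1]
    nlinarith
  · simp [f]

theorem isEntanglementStructure_of_dual_eq {K : Set (Herm (Fin d × Fin d))} (hK : dual K = K)
    (hS : SEP d ⊆ K) : IsEntanglementStructure K where
  isPositiveCone := isPositiveCone_of_dual_eq hK ⟨1, one_mem_interior hK hS⟩
  unit_mem_interior_dual := hK.symm ▸ one_mem_interior hK hS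
  sep_subset := hS
  subset_dual_sep := hK ▸ dual_anti hS

end Tensor
end EntanglementStructure
namespace EntanglementStructure

/-! ### Maximally entangled states -/

section MaximallyEntangled

open Matrix

variable {d : ℕ}

theorem basisMatrix_conjTranspose_mul_self
    (a : OrthonormalBasis (Fin d) ℂ (EuclideanSpace ℂ (Fin d))) :
    (Matrix.of fun i k => a k i)ᴴ * (Matrix.of fun i k => a k i) = 1 := by
  ext k l
  have h := orthonormal_iff_ite.1 a.orthonormal k l
  rw [PiLp.inner_apply] at h
  simpa [Matrix.mul_apply, Matrix.one_apply, mul_comm] using h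

/-- A vector in the tensor product is a `d × d` matrix; here it is `d^(-1/2) A Bᵀ`, where the
unitaries `A`, `B` have the basis vectors as columns. -/
theorem exists_unitary_of_mem_ME {σ : Herm (Fin d × Fin d)} (hσ : σ ∈ ME d) :
    ∃ U : Matrix (Fin d) (Fin d) ℂ, U * Uᴴ = 1 ∧
      ∀ p q, (σ : Matrix (Fin d × Fin d) (Fin d × Fin d) ℂ) p q =
        (d : ℂ)⁻¹ * (U p.1 p.2 * star (U q.1 q.2)) := by
  obtain ⟨a, b, h⟩ := hσ
  refine ⟨(Matrix.of fun i k => a k i) * (Matrix.of fun i k => b k i)ᵀ, ?_, fun p q => ?_⟩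
  · have ha := mul_eq_one_comm.1 (basisMatrix_conjTranspose_mul_self a)
    have hb := congrArg Matrix.transpose (basisMatrix_conjTranspose_mul_self b)
    rw [Matrix.transpose_mul, Matrix.transpose_one] at hb
    rw [conjTranspose_mul, Matrix.mul_assoc, ← Matrix.mul_assoc _ _ (of fun i k => a k i)ᴴ]
    rw [show ((of fun i k => b k i)ᵀᴴ : Matrix (Fin d) (Fin d) ℂ) =
      (of fun i k => b k i)ᴴᵀ from rfl, hb, Matrix.one_mul, ha]
  · have hs : ((Real.sqrt d : ℝ) : ℂ)⁻¹ * ((Real.sqrt d : ℝ) : ℂ)⁻¹ = (d : ℂ)⁻¹ := by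
      rw [← mul_inv, ← Complex.ofReal_mul, Real.mul_self_sqrt (Nat.cast_nonneg d)]
      simp
    rw [h, vecMulVec_apply, Pi.star_apply, maxEntVec, maxEntVec, star_mul', ← hs]
    simp only [Matrix.mul_apply, Matrix.of_apply, Matrix.transpose_apply, star_inv₀,
      Complex.star_def, Complex.conj_ofReal]
    ring

theorem mem_SES_of_mem_ME {σ : Herm (Fin d × Fin d)} (hσ : σ ∈ ME d) : σ ∈ SES d := by
  obtain ⟨a, b, h⟩ := hσ
  change (σ : Matrix (Fin d × Fin d) (Fin d × Fin d) ℂ).PosSemidef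
  rw [h]
  exact posSemidef_vecMulVec_self_star _

theorem sum_mul_star_of_unitary {U : Matrix (Fin d) (Fin d) ℂ} (hU : U * Uᴴ = 1) :
    ∑ p : Fin d × Fin d, U p.1 p.2 * star (U p.1 p.2) = d := by
  have h := congrArg Matrix.trace hU
  rw [Matrix.trace_one, Fintype.card_fin] at h
  rw [← h, Fintype.sum_prod_type]
  simp [Matrix.trace, Matrix.mul_apply]

theorem hsInner_one_of_mem_ME (hd : d ≠ 0) {σ : Herm (Fin d × Fin d)} (hσ : σ ∈ ME d) :
    hsInner σ 1 = 1 := by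
  obtain ⟨U, hU, h⟩ := exists_unitary_of_mem_ME hσ
  have : (σ : Matrix (Fin d × Fin d) (Fin d × Fin d) ℂ).trace = 1 := by
    simp only [Matrix.trace, Matrix.diag_apply, h]
    rw [← Finset.mul_sum, sum_mul_star_of_unitary hU, inv_mul_cancel₀ (Nat.cast_ne_zero.2 hd)]
  simp [hsInner, this]

theorem hsInner_self_of_mem_ME (hd : d ≠ 0) {σ : Herm (Fin d × Fin d)} (hσ : σ ∈ ME d) :
    hsInner σ σ = 1 := by
  obtain ⟨U, hU, h⟩ := exists_unitary_of_mem_ME hσ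
  have : ((σ : Matrix (Fin d × Fin d) (Fin d × Fin d) ℂ) * σ).trace = 1 := by
    have hd' : (d : ℂ) ≠ 0 := Nat.cast_ne_zero.2 hd
    have hs := sum_mul_star_of_unitary hU
    have : ((σ : Matrix (Fin d × Fin d) (Fin d × Fin d) ℂ) * σ).trace =
        (d : ℂ)⁻¹ * (d : ℂ)⁻¹ * ((∑ p : Fin d × Fin d, U p.1 p.2 * star (U p.1 p.2)) *
          ∑ p : Fin d × Fin d, U p.1 p.2 * star (U p.1 p.2)) := by
      rw [Finset.sum_mul_sum]
      simp only [Matrix.trace, Matrix.diag_apply, Matrix.mul_apply, h, Finset.mul_sum]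
      refine Finset.sum_congr rfl fun p _ => Finset.sum_congr rfl fun q _ => ?_
      ring
    rw [this, hs]
    field_simp
  simp [hsInner, this]

/-- A maximally entangled state overlaps a product state by at most `1 / d`. -/
theorem hsInner_hermKron_le_of_mem_ME {σ : Herm (Fin d × Fin d)} (hσ : σ ∈ ME d)
    {a b : Herm (Fin d)} (ha : a ∈ psd (Fin d)) (hb : b ∈ psd (Fin d)) :
    hsInner σ (hermKron a b) ≤ (d : ℝ)⁻¹ * hsInner 1 (hermKron a b) := by
  obtain ⟨U, hU, h⟩ := exists_unitary_of_mem_ME hσ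
  have hbT : ((b : Matrix (Fin d) (Fin d) ℂ)ᵀ).PosSemidef := PosSemidef.transpose hb
  have hle := trace_mul_le (show (a : Matrix (Fin d) (Fin d) ℂ).PosSemidef from ha)
    (hbT.mul_mul_conjTranspose_same U)
  have hcyc : (U * (b : Matrix (Fin d) (Fin d) ℂ)ᵀ * Uᴴ).trace =
      (b : Matrix (Fin d) (Fin d) ℂ).trace := by
    rw [Matrix.trace_mul_cycle, mul_eq_one_comm.1 hU, Matrix.one_mul, Matrix.trace_transpose]
  -- The overlap becomes `d⁻¹ Tr (a U bᵀ Uᴴ)`, to which `Tr (AB) ≤ Tr A Tr B` applies.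
  have h1 : ((σ : Matrix (Fin d × Fin d) (Fin d × Fin d) ℂ) * (hermKron a b)).trace =
      (d : ℂ)⁻¹ * ((a : Matrix (Fin d) (Fin d) ℂ) * (U * (b : Matrix (Fin d) (Fin d) ℂ)ᵀ * Uᴴ)).trace
      := by
    simp only [Matrix.trace, Matrix.diag_apply, Matrix.mul_apply, h, Finset.mul_sum, hermKron,
      kroneckerMap_apply, Matrix.transpose_apply, Matrix.conjTranspose_apply, Finset.sum_mul,
      Fintype.sum_prod_type]
    conv_rhs => rw [Finset.sum_comm]
    refine Finset.sum_congr rfl fun p₁ _ => ?_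
    rw [Finset.sum_comm]
    refine Finset.sum_congr rfl fun q₁ _ => ?_
    rw [Finset.sum_comm]
    refine Finset.sum_congr rfl fun q₂ _ => Finset.sum_congr rfl fun p₂ _ => ?_
    ring
  have h2 : hsInner 1 (hermKron a b) = ((a : Matrix (Fin d) (Fin d) ℂ).trace *
      (b : Matrix (Fin d) (Fin d) ℂ).trace).re := by
    rw [← Matrix.trace_kronecker]
    simp [hsInner, hermKron]
  rw [hcyc] at hle
  rw [h2, hsInner, h1]
  have h3 : ((d : ℂ)⁻¹) = (((d : ℝ)⁻¹ : ℝ) : ℂ) := by simp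
  rw [h3, Complex.re_ofReal_mul]
  exact mul_le_mul_of_nonneg_left (Complex.le_def.1 hle).1 (by positivity)

/-- Expand `⟨σ - τ, σ - τ⟩ > 0` for unit vectors `σ`, `τ`. -/
theorem hsInner_lt_one_of_ne (hd : d ≠ 0) {σ τ : Herm (Fin d × Fin d)} (hσ : σ ∈ ME d)
    (hτ : τ ∈ ME d) (hne : σ ≠ τ) : hsInner σ τ < 1 := by
  have h := hsInner_self_pos (sub_ne_zero.2 hne)
  rw [hsInner_sub_left, hsInner_sub_right, hsInner_sub_right, hsInner_self_of_mem_ME hd hσ,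
    hsInner_self_of_mem_ME hd hτ, hsInner_comm τ σ] at h
  linarith

theorem hsInner_le_one (hd : d ≠ 0) {σ τ : Herm (Fin d × Fin d)} (hσ : σ ∈ ME d)
    (hτ : τ ∈ ME d) : hsInner σ τ ≤ 1 := by
  by_cases hne : σ = τ
  · rw [hne, hsInner_self_of_mem_ME hd hτ]
  · exact (hsInner_lt_one_of_ne hd hσ hτ hne).le

/-- For `d ≥ 2` the phases of one basis vector give infinitely many maximally entangled states. -/
theorem ME_infinite (hd : 2 ≤ d) : (ME d).Infinite := by
  let i₀ : Fin d := ⟨0, by omega⟩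
  let i₁ : Fin d := ⟨1, by omega⟩
  have h01 : i₀ ≠ i₁ := by simp [i₀, i₁]
  let e := EuclideanSpace.basisFun (Fin d) ℂ
  have hon : ∀ z : Circle, Orthonormal ℂ fun k => (if k = i₀ then (z : ℂ) else 1) • e k := by
    intro z
    rw [orthonormal_iff_ite]
    intro k l
    rw [inner_smul_left, inner_smul_right, orthonormal_iff_ite.1 e.orthonormal k l]
    by_cases hkl : k = l
    · subst hkl
      by_cases hk : k = i₀ <;> simp [hk, ← Circle.coe_inv_eq_conj]
    · simp [hkl]
  let A : Circle → OrthonormalBasis (Fin d) ℂ (EuclideanSpace ℂ (Fin d)) := fun z =>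
    (OrthonormalBasis.mk (hon z) (by
      have hli := (hon z).linearIndependent
      rw [hli.span_eq_top_of_card_eq_finrank' (by simp)]))
  let σ : Circle → Herm (Fin d × Fin d) := fun z =>
    ⟨Matrix.vecMulVec (maxEntVec (A z) e) (star (maxEntVec (A z) e)),
      (posSemidef_vecMulVec_self_star _).1⟩
  have hσ : ∀ z, σ z ∈ ME d := fun z => ⟨A z, e, rfl⟩
  have hinf : Infinite Circle := by
    have : Infinite (Set.Ico (0 : ℝ) 1) := (Set.Ico_infinite one_pos).to_subtype
    exact Infinite.of_injective _ (Set.injOn_iff_injective.1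
      (Circle.exp_injOn_Ico (a := 0) (b := 1) (by linarith [Real.two_le_pi])))
  refine Set.infinite_of_injective_forall_mem (f := σ) (fun z w hzw => ?_) hσ
  -- This off-diagonal entry equals `z / d`; a diagonal entry would lose the phase.
  have h := congrArg (fun X : Herm (Fin d × Fin d) =>
    (X : Matrix (Fin d × Fin d) (Fin d × Fin d) ℂ) (i₀, i₀) (i₁, i₁)) hzw
  have hd' : (d : ℝ) ≠ 0 := by positivity
  have hv0 : ∀ z, maxEntVec (A z) e (i₀, i₀) = ((Real.sqrt d : ℝ) : ℂ)⁻¹ * z := by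
    intro z
    rw [maxEntVec, Finset.sum_eq_single i₀]
    · simp [A, e]
    · intro k _ hk; simp [A, e, hk.symm]
    · simp
  have hv1 : ∀ z, maxEntVec (A z) e (i₁, i₁) = ((Real.sqrt d : ℝ) : ℂ)⁻¹ := by
    intro z
    rw [maxEntVec, Finset.sum_eq_single i₁]
    · simp [A, e, h01.symm]
    · intro k _ hk; simp [A, e, hk.symm]
    · simp
  simp only [σ, vecMulVec_apply, Pi.star_apply, hv0, hv1] at h
  have hs : ((Real.sqrt d : ℝ) : ℂ) ≠ 0 := by
    rw [Complex.ofReal_ne_zero]; positivity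
  have h' := mul_right_cancel₀ (star_ne_zero.2 (inv_ne_zero hs)) h
  exact Circle.ext (mul_left_cancel₀ (inv_ne_zero hs) h')

end MaximallyEntangled
end EntanglementStructure
namespace EntanglementStructure

/-! ### Noisy states, witnesses and the independent family -/

section Construction

open Matrix

variable {d : ℕ}

/-- The maximally entangled state `σ` mixed with the weight `δ` of the maximally mixed state. -/
noncomputable def mixedState (δ : ℝ) (σ : Herm (Fin d × Fin d)) : Herm (Fin d × Fin d) :=
  (1 - δ) • σ + (δ / (d : ℝ) ^ 2) • (1 : Herm (Fin d × Fin d))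

theorem smul_add_smul_mem_SES {a b : ℝ} (ha : 0 ≤ a) (hb : 0 ≤ b)
    {X Y : Herm (Fin d × Fin d)} (hX : X ∈ SES d) (hY : Y ∈ SES d) : a • X + b • Y ∈ SES d :=
  PosSemidef.add (PosSemidef.smul hX ha) (PosSemidef.smul hY hb)

theorem mixedState_mem_SES {δ : ℝ} (h0 : 0 ≤ δ) (h1 : δ ≤ 1) {σ : Herm (Fin d × Fin d)}
    (hσ : σ ∈ ME d) : mixedState δ σ ∈ SES d :=
  smul_add_smul_mem_SES (sub_nonneg.2 h1) (by positivity) (mem_SES_of_mem_ME hσ) PosSemidef.one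

theorem hsInner_unit_unit : hsInner (1 : Herm (Fin d × Fin d)) 1 = (d : ℝ) ^ 2 := by
  rw [hsInner_one_one]; simp [pow_two]

theorem hsInner_mixedState_one (hd : d ≠ 0) (δ : ℝ) {σ : Herm (Fin d × Fin d)} (hσ : σ ∈ ME d) :
    hsInner (mixedState δ σ) 1 = 1 := by
  have hd' : (d : ℝ) ≠ 0 := Nat.cast_ne_zero.2 hd
  rw [mixedState, hsInner_add_left, hsInner_smul_left, hsInner_smul_left,
    hsInner_one_of_mem_ME hd hσ, hsInner_unit_unit]
  field_simp
  ring

/-- The Hilbert–Schmidt norm of the difference is at most `δ`; the factor `d` is the square root of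
the dimension `d ^ 2`. -/
theorem traceNorm_mixedState_sub_le (hd : d ≠ 0) {δ : ℝ} (h0 : 0 ≤ δ) {σ : Herm (Fin d × Fin d)}
    (hσ : σ ∈ ME d) : traceNorm (mixedState δ σ - σ) ≤ d * δ := by
  have hd' : (0 : ℝ) < d := Nat.cast_pos.2 (Nat.pos_of_ne_zero hd)
  have h := traceNorm_sq_le (mixedState δ σ - σ)
  have e : mixedState δ σ - σ = δ • (((d : ℝ) ^ 2)⁻¹ • (1 : Herm (Fin d × Fin d)) - σ) := by
    rw [mixedState, smul_sub, smul_smul, sub_smul, one_smul, div_eq_mul_inv]; abel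
  have hY : hsInner (mixedState δ σ - σ) (mixedState δ σ - σ) ≤ δ ^ 2 := by
    have : hsInner (mixedState δ σ - σ) (mixedState δ σ - σ) =
        δ ^ 2 * (1 - ((d : ℝ) ^ 2)⁻¹) := by
      rw [e]
      simp only [hsInner_smul_left, hsInner_smul_right, hsInner_sub_left, hsInner_sub_right,
        hsInner_unit_unit, hsInner_comm 1 σ, hsInner_one_of_mem_ME hd hσ,
        hsInner_self_of_mem_ME hd hσ]
      field_simp
      ring
    rw [this]
    have : 0 ≤ ((d : ℝ) ^ 2)⁻¹ := by positivity
    nlinarith [sq_nonneg δ]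
  have hc : ((Fintype.card (Fin d × Fin d) : ℕ) : ℝ) = (d : ℝ) ^ 2 := by simp [pow_two]
  rw [hc] at h
  refine le_of_sq_le_sq ?_ (by positivity)
  calc _ ≤ _ := h
    _ ≤ (d : ℝ) ^ 2 * δ ^ 2 := by gcongr
    _ = _ := by ring

/-- An operator that is non-negative on product states, but negative on `φ` once `1 < t`. -/
noncomputable def witness (t : ℝ) (φ : Herm (Fin d × Fin d)) : Herm (Fin d × Fin d) := 1 - t • φ

theorem hsInner_witness_mem_ME (hd : d ≠ 0) (t : ℝ) {φ σ : Herm (Fin d × Fin d)} (hσ : σ ∈ ME d) :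
    hsInner (witness t φ) σ = 1 - t * hsInner φ σ := by
  rw [witness, hsInner_sub_left, hsInner_smul_left, hsInner_comm, hsInner_one_of_mem_ME hd hσ]

/-- The overlap bound `1 / d ≤ 1 / 2` leaves room for every `t ≤ 2`. -/
theorem hsInner_witness_nonneg_of_mem_SEP (hd : 2 ≤ d) {t : ℝ} (h0 : 0 ≤ t) (h2 : t ≤ 2)
    {φ X : Herm (Fin d × Fin d)} (hφ : φ ∈ ME d) (hX : X ∈ SEP d) :
    0 ≤ hsInner (witness t φ) X := by
  refine hsInner_nonneg_of_mem_SEP hX fun a ha b hb => ?_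
  rw [witness, hsInner_sub_left, hsInner_smul_left]
  have h := hsInner_hermKron_le_of_mem_ME hφ ha hb
  have hp : 0 ≤ hsInner 1 (hermKron a b) :=
    hsInner_nonneg_of_psd PosSemidef.one (SEP_subset_SES (hermKron_mem_SEP ha hb))
  have hd' : (2 : ℝ) ≤ d := by exact_mod_cast hd
  have ht : t * (d : ℝ)⁻¹ ≤ 1 := by
    rw [← div_eq_mul_inv, div_le_one (by linarith)]; linarith
  nlinarith [mul_le_mul_of_nonneg_left h h0, mul_le_mul_of_nonneg_right ht hp]

/-- The entangled part contributes at least `-(1 - δ) δ / 2`, since `1 - t ≥ -δ / 2`; the noise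
contributes `δ (1 - t / d ^ 2) ≥ δ / 2`, which outweighs it. -/
theorem hsInner_witness_mixedState_nonneg (hd : 2 ≤ d) {t δ : ℝ} (h1 : 1 ≤ t) (hδ : δ ≤ 1 / 2)
    (ht : t ≤ 1 + δ / 2) {φ σ : Herm (Fin d × Fin d)} (hφ : φ ∈ ME d) (hσ : σ ∈ ME d) :
    0 ≤ hsInner (witness t φ) (mixedState δ σ) := by
  have hd0 : d ≠ 0 := by omega
  have hd' : (2 : ℝ) ≤ d := by exact_mod_cast hd
  have hF := hsInner_le_one hd0 hφ hσ
  have hone : hsInner (witness t φ) 1 = (d : ℝ) ^ 2 - t := by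
    rw [witness, hsInner_sub_left, hsInner_smul_left, hsInner_unit_unit,
      hsInner_one_of_mem_ME hd0 hφ, mul_one]
  rw [mixedState, hsInner_add_right, hsInner_smul_right, hsInner_smul_right,
    hsInner_witness_mem_ME hd0 t hσ, hone]
  have hδ0 : 0 ≤ δ := by linarith
  have hr : δ / (d : ℝ) ^ 2 * ((d : ℝ) ^ 2 - t) = δ * (1 - t / (d : ℝ) ^ 2) := by field_simp
  have hq : t / (d : ℝ) ^ 2 ≤ 1 / 2 := by
    rw [div_le_iff₀ (by positivity)]; nlinarith
  rw [hr]
  nlinarith [mul_le_mul_of_nonneg_left hF (show 0 ≤ t by linarith),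
    mul_le_mul_of_nonneg_left hq hδ0,
    mul_nonneg (show 0 ≤ 1 - δ by linarith) (show 0 ≤ t * (1 - hsInner φ σ) by
      exact mul_nonneg (by linarith) (by linarith)), mul_nonneg hδ0 (show 0 ≤ t - 1 by linarith)]

/-- A self-dual cone that contains the separable cone, the states near the maximally entangled
ones, a witness for `φ`, and given maximally entangled states on which it is non-negative. -/
theorem exists_selfDual_witness_mem (hd : 2 ≤ d) {t δ : ℝ} (h1 : 1 ≤ t) (hδ : δ ≤ 1 / 2)
    (ht : t ≤ 1 + δ / 2) {φ : Herm (Fin d × Fin d)} (hφ : φ ∈ ME d)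
    {S : Set (Herm (Fin d × Fin d))} (hS : S ⊆ ME d) (hφS : ∀ σ ∈ S, t * hsInner φ σ ≤ 1) :
    ∃ K, dual K = K ∧ SEP d ⊆ K ∧ (∀ σ ∈ ME d, mixedState δ σ ∈ K) ∧ witness t φ ∈ K ∧ S ⊆ K := by
  let P := SEP d ∪ mixedState δ '' ME d ∪ S
  have hδ0 : 0 ≤ δ := by linarith
  have hP : P ⊆ SES d := by
    rintro x ((hx | ⟨σ, hσ, rfl⟩) | hx)
    · exact SEP_subset_SES hx
    · exact mixedState_mem_SES hδ0 (by linarith) hσ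
    · exact mem_SES_of_mem_ME (hS hx)
  have hw : ∀ x ∈ P, 0 ≤ hsInner (witness t φ) x := by
    rintro x ((hx | ⟨σ, hσ, rfl⟩) | hx)
    · exact hsInner_witness_nonneg_of_mem_SEP hd (by linarith) (by linarith) hφ hx
    · exact hsInner_witness_mixedState_nonneg hd h1 hδ ht hφ hσ
    · rw [hsInner_witness_mem_ME (by omega) t (hS hx)]
      linarith [hφS x hx]
  obtain ⟨K, hwK, hPK, hK⟩ := exists_selfDual_insert
    (fun x hx y hy => hsInner_nonneg_of_psd (hP hx) (hP hy)) hw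
  exact ⟨K, hK, fun x hx => hPK (.inl (.inl hx)),
    fun σ hσ => hPK (.inl (.inr (Set.mem_image_of_mem _ hσ))), hwK, fun x hx => hPK (.inr hx)⟩

theorem maxEntDist_le_of_mixedState_mem (hd : d ≠ 0) {δ : ℝ} (h0 : 0 ≤ δ)
    {K : Set (Herm (Fin d × Fin d))} (hK : ∀ σ ∈ ME d, mixedState δ σ ∈ K) :
    maxEntDist K ≤ ENNReal.ofReal (d * δ) :=
  iSup₂_le fun σ hσ => iInf₂_le_of_le (mixedState δ σ) ⟨hK σ hσ, hsInner_mixedState_one hd δ hσ⟩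
    (ENNReal.ofReal_le_ofReal (traceNorm_mixedState_sub_le hd h0 hσ))

theorem exists_independent_PSES (hd : 2 ≤ d) {ε : ℝ} (hε : 0 < ε) (n : ℕ) :
    ∃ K : Fin n → Set (Herm (Fin d × Fin d)),
      (∀ i, IsPSES ε (K i) ∧ K i ≠ SES d) ∧ IsIndependentFamily K := by
  have hd0 : d ≠ 0 := by omega
  have hd' : (0 : ℝ) < d := by positivity
  let φ : Fin n → Herm (Fin d × Fin d) := fun i => (ME_infinite hd).natEmbedding _ i
  have hφ : ∀ i, φ i ∈ ME d := fun i => ((ME_infinite hd).natEmbedding _ i).2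
  have hinj : ∀ i j, i ≠ j → φ i ≠ φ j := fun i j hij h =>
    hij (Fin.ext (((ME_infinite hd).natEmbedding _).injective (Subtype.ext h)))
  -- `ε / d` absorbs the factor `d` of the trace-norm bound; `1 / 2` is what the witness estimate
  -- needs.
  let δ := min (ε / d) (1 / 2)
  have hδ0 : 0 < δ := by positivity
  have hδ : δ ≤ 1 / 2 := min_le_right _ _
  have hδε : d * δ ≤ ε := by
    have := min_le_left (ε / d) (1 / 2)
    rwa [le_div_iff₀ hd', mul_comm] at this
  -- Finitely many overlaps, all strictly below 1, so every `t > 1` close enough to 1 works.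
  obtain ⟨t, ht1, htδ, htF⟩ : ∃ t : ℝ, 1 < t ∧ t ≤ 1 + δ / 2 ∧
      ∀ i j, i ≠ j → t * hsInner (φ i) (φ j) ≤ 1 := by
    have hev : ∀ᶠ t in nhdsWithin (1 : ℝ) (Set.Ioi 1), 1 < t ∧ t ≤ 1 + δ / 2 ∧
        ∀ i j, i ≠ j → t * hsInner (φ i) (φ j) ≤ 1 := by
      refine Filter.Eventually.and self_mem_nhdsWithin (Filter.Eventually.filter_mono
        nhdsWithin_le_nhds
        ((eventually_le_nhds (by linarith)).and (Filter.eventually_all.2 fun i =>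
          Filter.eventually_all.2 fun j => ?_)))
      by_cases hij : i = j
      · simp [hij]
      · have hlt : 1 * hsInner (φ i) (φ j) < 1 := by
          rw [one_mul]; exact hsInner_lt_one_of_ne hd0 (hφ i) (hφ j) (hinj i j hij)
        have hcont : Continuous fun t : ℝ => t * hsInner (φ i) (φ j) := by fun_prop
        exact (hcont.tendsto 1 |>.eventually_lt_const hlt).mono fun t ht _ => ht.le
    exact hev.exists
  choose K hK hSEP hmix hwit hS using fun i => exists_selfDual_witness_mem hd ht1.le hδ htδ (hφ i)
    (S := φ '' {j | i ≠ j}) (by rintro _ ⟨j, _, rfl⟩; exact hφ j)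
    (by rintro _ ⟨j, hj, rfl⟩; exact htF i j hj)
  have hneg : ∀ i, hsInner (φ i) (witness t (φ i)) < 0 := fun i => by
    rw [hsInner_comm, hsInner_witness_mem_ME hd0 t (hφ i), hsInner_self_of_mem_ME hd0 (hφ i)]
    linarith
  refine ⟨K, fun i => ⟨⟨isEntanglementStructure_of_dual_eq (hK i) (hSEP i), hK i, ?_⟩, ?_⟩, ?_⟩
  · exact (maxEntDist_le_of_mixedState_mem hd0 hδ0.le (hmix i)).trans
      (ENNReal.ofReal_le_ofReal hδε)
  · intro h
    have hw := hwit i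
    rw [h] at hw
    exact (hneg i).not_ge (hsInner_nonneg_of_psd (mem_SES_of_mem_ME (hφ i)) hw)
  -- The roles are swapped: the states `φ i` are the separating functionals, and the entanglement
  -- witnesses are the elements of `K i` they detect.
  · refine isIndependentFamily_of_witness φ (fun i => witness t (φ i)) hwit (fun i j hij => ?_) hneg
    rw [hK j]
    exact hS j ⟨i, hij.symm, rfl⟩

theorem infinite_PSES (hd : 2 ≤ d) {ε : ℝ} (hε : 0 < ε) :
    {K : Set (Herm (Fin d × Fin d)) | IsPSES ε K ∧ K ≠ SES d}.Infinite := by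
  intro hfin
  obtain ⟨K, hK, hind⟩ := exists_independent_PSES hd hε (hfin.toFinset.card + 1)
  have hinj := hind.injective fun i => (hK i).1.selfDual ▸ zero_mem_dual _
  have h := Finset.card_le_card_of_injOn (s := Finset.univ) (t := hfin.toFinset) K
    (fun i _ => by simpa using hK i) hinj.injOn
  simp at h

end Construction
end EntanglementStructure

theorem theorem3 (d : ℕ) (hd : 2 ≤ d) (ε : ℝ) (hε : 0 < ε) :
    {K : Set (EntanglementStructure.Herm (Fin d × Fin d)) |
        EntanglementStructure.IsPSES ε K ∧ K ≠ EntanglementStructure.SES d}.Infinite ∧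
      ∀ n : ℕ, ∃ K : Fin n → Set (EntanglementStructure.Herm (Fin d × Fin d)),
        (∀ i, EntanglementStructure.IsPSES ε (K i) ∧ K i ≠ EntanglementStructure.SES d) ∧
        EntanglementStructure.IsIndependentFamily K :=
  ⟨EntanglementStructure.infinite_PSES hd hε,
    fun n => EntanglementStructure.exists_independent_PSES hd hε n⟩
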